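/- Let $H$ be a complex Hilbert space, let $X\subseteq \mathcal B(H)$ be a linear subspace containing the identity operator, and let $C=C^*(X)\subseteq\mathcal B(H)$ be the $C^*$-algebra generated by $X$. For a linear subspace $V\subseteq\mathcal B(H)$ and $n\ge 1$, give $M_n(\mathcal B(H)/V)=M_n(\mathcal B(H))/M_n(V)$ the quotient seminorm $$\|[x_{ij}+V]\|=\inf\{\|[x_{ij}+y_{ij}]\| : y_{ij}\in V\},$$ and say that the quotient map $q_V$ is completely isometric on $X$ if $\|[x_{ij}+V]\|=\|[x_{ij}]\|$ for all $n\ge1$ and all $[x_{ij}]\in M_n(X)$. A *boundary subsystem* for $X$ in $C$ is a selfadjoint linear subspace $V\subseteq C$ such that $q_V$ is completely isometric on $X$. A *boundary ideal* for $X$ in $C$ is a closed two-sided ideal $J$ of $C$ such that $q_J$ is completely isometric on $X$. The *Šilov ideal* of $X$ in $C$ is the largest boundary ideal for $X$ in $C$ (one containing all the others). A *boundary element* is a selfadjoint operator $a\in\mathcal B(H)$ such that $q_{\mathbb C a}$ is completely isometric on $X$. Then the Šilov ideal $I$ of $X$ in $C$ exists, and: 1. $I$ contains every boundary subsystem for $X$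 in $C$, and it contains the closed linear span of the set of all boundary elements that lie in $C$. 2. For every boundary subsystem $V$ for $X$ in $C$, the closed two-sided ideal of $C$ generated by $V$ is a boundary ideal for $X$ in $C$. -/

import Mathlib

namespace Silov

/-- `M_n(V)`: the subspace of those matrices in the C*-algebra `M_n(A)` (with its C*-norm)
all of whose entries lie in the subspace `V` of `A`. -/
def matrixSubspace {A : Type*} [CStarAlgebra A] (n : ℕ) (V : Submodule ℂ A) :
    Submodule ℂ (CStarMatrix (Fin n) (Fin n) A) where
  carrier := {M | ∀ i j, M i j ∈ V}
  add_mem' hM hN i j := V.add_mem (hM i j) (hN i j)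
  zero_mem' _ _ := V.zero_mem
  smul_mem' c _ hM i j := V.smul_mem c (hM i j)

/-- The restriction to `X` of the quotient map `A → A / V` is completely isometric, where
`M_n(A / V)` carries the quotient seminorm of `M_n(A) / M_n(V)`, that is
`‖[x i j + V]‖ = inf {‖[x i j + y i j]‖ | y i j ∈ V}`. -/
def QuotientCompletelyIsometricOn {A : Type*} [CStarAlgebra A] [PartialOrder A] [StarOrderedRing A] (X V : Submodule ℂ A) : Prop :=
  ∀ (n : ℕ), ∀ x ∈ matrixSubspace n X, ‖(matrixSubspace n V).mkQ x‖ = ‖x‖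

/-- `V` is a boundary subsystem for `X` in the operator system `S` (where `X ≤ S`): a selfadjoint
linear subspace of `S` such that the quotient map by `V` is completely isometric on `X`. -/
structure IsBoundarySubsystem {A : Type*} [CStarAlgebra A] [PartialOrder A] [StarOrderedRing A] (X S V : Submodule ℂ A) : Prop where
  le : V ≤ S
  star_mem : ∀ v ∈ V, star v ∈ V
  completelyIsometric : QuotientCompletelyIsometricOn X V

/-- A selfadjoint element whose linear span is a boundary subsystem for `X`. -/
def IsBoundaryElement {A : Type*} [CStarAlgebra A] [PartialOrder A] [StarOrderedRing A] (X : Submodule ℂ A) (a : A) : Prop :=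
  IsSelfAdjoint a ∧ IsBoundarySubsystem X ⊤ (Submodule.span ℂ {a})

/-- `C*(X)`: the C*-subalgebra generated by `X` (and the unit). -/
def cstarGenerated {A : Type*} [CStarAlgebra A] (X : Submodule ℂ A) : StarSubalgebra ℂ A :=
  (StarAlgebra.adjoin ℂ (X : Set A)).topologicalClosure

/-- The underlying linear subspace of a star subalgebra. -/
def subalgebraSubspace {A : Type*} [CStarAlgebra A] (C : StarSubalgebra ℂ A) : Submodule ℂ A :=
  Subalgebra.toSubmodule C.toSubalgebra

/-- A two-sided ideal of `C ⊆ A`, viewed as a linear subspace of `A`. -/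
noncomputable def idealSubspace {A : Type*} [CStarAlgebra A] {C : StarSubalgebra ℂ A} (I : TwoSidedIdeal C) :
    Submodule ℂ A :=
  (I.asIdeal.restrictScalars ℂ).map C.toSubalgebra.val.toLinearMap

/-- `I` is a boundary ideal for `X` in `C`: a closed two-sided ideal of `C` such that the quotient
map by `I` is completely isometric on `X`. -/
structure IsBoundaryIdeal {A : Type*} [CStarAlgebra A] [PartialOrder A] [StarOrderedRing A] {C : StarSubalgebra ℂ A}
    (X : Submodule ℂ A) (I : TwoSidedIdeal C) : Prop where
  isClosed : IsClosed {c : C | c ∈ I}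
  completelyIsometric : QuotientCompletelyIsometricOn X (idealSubspace I)

/-- `I` is the Silov ideal of `X` in `C`: the largest boundary ideal. -/
def IsSilovIdeal {A : Type*} [CStarAlgebra A] [PartialOrder A] [StarOrderedRing A] {C : StarSubalgebra ℂ A}
    (X : Submodule ℂ A) (I : TwoSidedIdeal C) : Prop :=
  IsGreatest {J : TwoSidedIdeal C | IsBoundaryIdeal X J} I

/-- The ideal of the C*-algebra `C` generated by `V ⊆ C`: the smallest closed two-sided ideal of
`C` containing `V`. -/
def closedIdealGenerated {A : Type*} [CStarAlgebra A] (C : StarSubalgebra ℂ A)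
    (V : Submodule ℂ A) : TwoSidedIdeal C :=
  sInf {J : TwoSidedIdeal C | IsClosed {c : C | c ∈ J} ∧ V ≤ idealSubspace J}

end Silov

namespace Silov
open scoped ComplexOrder InnerProductSpace

section CStarAlgebra

variable {B : Type*} [CStarAlgebra B] [PartialOrder B] [StarOrderedRing B]

lemma exists_eq_star_mul_self {b : B} (hb : 0 ≤ b) : ∃ c, b = star c * c :=
  CStarAlgebra.nonneg_iff_eq_star_mul_self.1 hb

lemma exists_negPart {b : B} (hb : IsSelfAdjoint b) :
    ∃ c, 0 ≤ c * c * c ∧ star c * (b * c) = -(c * c * c) ∧ (c * c * c = 0 → 0 ≤ b) := by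
  have hN : 0 ≤ b⁻ := CFC.negPart_nonneg b
  have hNs : star b⁻ = b⁻ := hN.isSelfAdjoint
  refine ⟨b⁻, by simpa [hNs] using star_left_conjugate_nonneg hN b⁻, ?_, fun h3 ↦ ?_⟩
  · have h : b * b⁻ = -(b⁻ * b⁻) := by
      nth_rw 1 [← CFC.posPart_sub_negPart b hb]
      rw [sub_mul, CFC.posPart_mul_negPart, zero_sub]
    rw [hNs, h, mul_neg, mul_assoc]
  · have h2 : b⁻ * b⁻ = 0 := by
      rw [← CStarRing.star_mul_self_eq_zero_iff, star_mul, hNs, ← mul_assoc, h3, zero_mul]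
    have h1 : b⁻ = 0 := by rw [← CStarRing.star_mul_self_eq_zero_iff, hNs, h2]
    rw [← CFC.posPart_sub_negPart b hb, h1, sub_zero]
    exact CFC.posPart_nonneg b

lemma star_mul_self_le_iff {b : B} {r : ℝ} (hr : 0 ≤ r) :
    star b * b ≤ ((r ^ 2 : ℝ) : ℂ) • (1 : B) ↔ ‖b‖ ≤ r := by
  rw [Complex.coe_smul, ← Algebra.algebraMap_eq_smul_one,
    ← CStarAlgebra.norm_le_iff_le_algebraMap _ (sq_nonneg r) (star_mul_self_nonneg b),
    CStarRing.norm_star_mul_self, ← sq, sq_le_sq₀ (norm_nonneg b) hr]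

end CStarAlgebra

section

variable {H : Type*} [NormedAddCommGroup H] [InnerProductSpace ℂ H]

/-- The action of an operator matrix on column vectors. -/
noncomputable def act {n : ℕ} (M : CStarMatrix (Fin n) (Fin n) (H →L[ℂ] H)) (h : Fin n → H) :
    Fin n → H :=
  fun i ↦ ∑ j, M i j (h j)

/-- The inner product of column vectors. -/
noncomputable def pairing {n : ℕ} (h k : Fin n → H) : ℂ := ∑ i, ⟪h i, k i⟫_ℂ

lemma act_mul {n : ℕ} (M N : CStarMatrix (Fin n) (Fin n) (H →L[ℂ] H)) (h : Fin n → H) :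
    act (M * N) h = act M (act N h) := by
  ext i
  simp only [act, CStarMatrix.mul_apply, sum_apply, mul_apply_eq_comp, map_sum]
  exact Finset.sum_comm

lemma pairing_act {n : ℕ} (M : CStarMatrix (Fin n) (Fin n) (H →L[ℂ] H)) (h k : Fin n → H) :
    pairing h (act M k) = ∑ i, ∑ j, ⟪h i, M i j (k j)⟫_ℂ := by
  simp [pairing, act]

lemma pairing_conj {n : ℕ} (h k : Fin n → H) : starRingEnd ℂ (pairing h k) = pairing k h := by
  simp [pairing]

lemma pairing_self {n : ℕ} (h : Fin n → H) : pairing h h = ((∑ i, ‖h i‖ ^ 2 : ℝ) : ℂ) := by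
  simp [pairing, inner_self_eq_norm_sq_to_K]

lemma pairing_self_nonneg {n : ℕ} (h : Fin n → H) : 0 ≤ pairing h h := by
  rw [pairing_self]
  exact_mod_cast Finset.sum_nonneg fun i _ ↦ sq_nonneg ‖h i‖

lemma eq_zero_of_pairing_self {n : ℕ} {h : Fin n → H} (hh : pairing h h = 0) : h = 0 := by
  rw [pairing_self] at hh
  have h0 : ∑ i, ‖h i‖ ^ 2 = 0 := by exact_mod_cast hh
  ext i
  simpa using (Finset.sum_eq_zero_iff_of_nonneg fun i _ ↦ sq_nonneg ‖h i‖).1 h0 i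

lemma act_single {n : ℕ} (M : CStarMatrix (Fin n) (Fin n) (H →L[ℂ] H)) (j : Fin n) (x : H)
    (i : Fin n) : act M (Pi.single j x) i = M i j x := by
  rw [act, Finset.sum_eq_single j]
  · simp
  · intro k _ hk
    simp [hk]
  · simp

lemma eq_zero_of_act {n : ℕ} {M : CStarMatrix (Fin n) (Fin n) (H →L[ℂ] H)}
    (hM : ∀ h, act M h = 0) : M = 0 := by
  ext i j x
  simpa [act_single] using congrFun (hM (Pi.single j x)) i

lemma act_sub {n : ℕ} (M N : CStarMatrix (Fin n) (Fin n) (H →L[ℂ] H)) (h : Fin n → H) :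
    act (M - N) h = act M h - act N h := by
  ext i; simp [act]

lemma act_neg {n : ℕ} (M : CStarMatrix (Fin n) (Fin n) (H →L[ℂ] H)) (h : Fin n → H) :
    act (-M) h = - act M h := by
  ext i; simp [act]

lemma act_smul {n : ℕ} (c : ℂ) (M : CStarMatrix (Fin n) (Fin n) (H →L[ℂ] H)) (h : Fin n → H) :
    act (c • M) h = c • act M h := by
  ext i; simp [act, Finset.smul_sum]

lemma act_one {n : ℕ} (h : Fin n → H) :
    act (1 : CStarMatrix (Fin n) (Fin n) (H →L[ℂ] H)) h = h := by
  ext i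
  rw [act, Finset.sum_eq_single i]
  · simp
  · intro k _ hk
    simp [hk.symm]
  · simp

lemma pairing_sub {n : ℕ} (h k l : Fin n → H) :
    pairing h (k - l) = pairing h k - pairing h l := by
  simp [pairing]

lemma pairing_neg {n : ℕ} (h k : Fin n → H) : pairing h (-k) = - pairing h k := by
  simp [pairing]

lemma pairing_smul {n : ℕ} (c : ℂ) (h k : Fin n → H) :
    pairing h (c • k) = c * pairing h k := by
  simp [pairing, Finset.mul_sum]

variable [CompleteSpace H]

lemma pairing_act_star {n : ℕ} (M : CStarMatrix (Fin n) (Fin n) (H →L[ℂ] H)) (h k : Fin n → H) :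
    pairing h (act (star M) k) = pairing (act M h) k := by
  simp only [pairing, act, inner_sum, sum_inner, CStarMatrix.star_apply,
    ContinuousLinearMap.star_eq_adjoint, ContinuousLinearMap.adjoint_inner_right]
  exact Finset.sum_comm

lemma pairing_act_nonneg {n : ℕ} {M : CStarMatrix (Fin n) (Fin n) (H →L[ℂ] H)} (hM : 0 ≤ M)
    (h : Fin n → H) : 0 ≤ pairing h (act M h) := by
  obtain ⟨B, rfl⟩ := exists_eq_star_mul_self hM
  rw [act_mul, pairing_act_star]
  exact pairing_self_nonneg _

lemma eq_zero_of_nonneg_of_pairing {n : ℕ} {M : CStarMatrix (Fin n) (Fin n) (H →L[ℂ] H)}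
    (hM : 0 ≤ M) (h : ∀ h, pairing h (act M h) ≤ 0) : M = 0 := by
  obtain ⟨B, rfl⟩ := exists_eq_star_mul_self hM
  have hB : B = 0 := eq_zero_of_act fun k ↦ eq_zero_of_pairing_self <| by
    refine le_antisymm ?_ (pairing_self_nonneg _)
    simpa only [act_mul, pairing_act_star] using h k
  simp [hB]

lemma nonneg_of_isSelfAdjoint_of_pairing {n : ℕ} {M : CStarMatrix (Fin n) (Fin n) (H →L[ℂ] H)}
    (hs : IsSelfAdjoint M) (hM : ∀ h, 0 ≤ pairing h (act M h)) : 0 ≤ M := by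
  obtain ⟨N, h0, h1, h2⟩ := exists_negPart hs
  refine h2 (eq_zero_of_nonneg_of_pairing h0 fun h ↦ ?_)
  have := hM (act N h)
  rw [← act_mul, ← pairing_act_star, ← act_mul, h1, act_neg, pairing_neg] at this
  simpa using this

/-- An operator matrix is positive if its quadratic form is. -/
lemma nonneg_of_pairing {n : ℕ} {M : CStarMatrix (Fin n) (Fin n) (H →L[ℂ] H)}
    (hM : ∀ h, 0 ≤ pairing h (act M h)) : 0 ≤ M := by
  have hstar : ∀ h, pairing h (act (star M) h) = pairing h (act M h) := fun h ↦ by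
    rw [pairing_act_star, ← pairing_conj]
    exact Complex.conj_eq_iff_im.2 (Complex.nonneg_iff.1 (hM h)).2.symm
  have hD : IsSelfAdjoint (Complex.I • (M - star M)) := by
    rw [isSelfAdjoint_iff, star_smul, star_sub, star_star]
    simp [← smul_neg]
  have hD0 : ∀ h, pairing h (act (Complex.I • (M - star M)) h) = 0 := fun h ↦ by
    rw [act_smul, act_sub, pairing_smul, pairing_sub, hstar, sub_self, mul_zero]
  have hD1 : Complex.I • (M - star M) = 0 :=
    eq_zero_of_nonneg_of_pairing
      (nonneg_of_isSelfAdjoint_of_pairing hD fun h ↦ (hD0 h).ge) fun h ↦ (hD0 h).le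
  refine nonneg_of_isSelfAdjoint_of_pairing ?_ hM
  rw [smul_eq_zero, sub_eq_zero] at hD1
  exact (hD1.resolve_left Complex.I_ne_zero).symm

lemma norm_le_of_pairing {n : ℕ} {M : CStarMatrix (Fin n) (Fin n) (H →L[ℂ] H)} {r : ℝ}
    (hr : 0 ≤ r) (hM : ∀ h, pairing (act M h) (act M h) ≤ ((r ^ 2 : ℝ) : ℂ) * pairing h h) :
    ‖M‖ ≤ r := by
  rw [← star_mul_self_le_iff hr, ← sub_nonneg]
  refine nonneg_of_pairing fun h ↦ ?_
  rw [act_sub, act_mul, pairing_sub, pairing_act_star, act_smul, act_one, pairing_smul, sub_nonneg]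
  exact hM h

lemma sub_star_mul_self_nonneg {n : ℕ} (M : CStarMatrix (Fin n) (Fin n) (H →L[ℂ] H)) :
    0 ≤ ((‖M‖ ^ 2 : ℝ) : ℂ) • (1 : CStarMatrix (Fin n) (Fin n) (H →L[ℂ] H)) - star M * M :=
  sub_nonneg.2 ((star_mul_self_le_iff (norm_nonneg M)).2 le_rfl)

lemma pairing_act_self_le {n : ℕ} (M : CStarMatrix (Fin n) (Fin n) (H →L[ℂ] H)) (h : Fin n → H) :
    pairing (act M h) (act M h) ≤ ((‖M‖ ^ 2 : ℝ) : ℂ) * pairing h h := by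
  have := pairing_act_nonneg (sub_star_mul_self_nonneg M) h
  rwa [act_sub, act_smul, act_one, pairing_sub, pairing_smul, act_mul, pairing_act_star,
    sub_nonneg] at this

end

end Silov

namespace Silov
open scoped ComplexOrder InnerProductSpace

section

variable {H : Type*} [NormedAddCommGroup H] [InnerProductSpace ℂ H] [CompleteSpace H]

lemma inner_star_apply (T : H →L[ℂ] H) (h k : H) : ⟪h, star T k⟫_ℂ = ⟪T h, k⟫_ℂ := by
  rw [ContinuousLinearMap.star_eq_adjoint, ContinuousLinearMap.adjoint_inner_right]

/-- Complete positivity of a linear map on `B(H)`, expressed through vectors. -/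
def IsCP (φ : (H →L[ℂ] H) →ₗ[ℂ] (H →L[ℂ] H)) : Prop :=
  ∀ (n : ℕ) (a : Fin n → H →L[ℂ] H) (h : Fin n → H),
    0 ≤ ∑ i, ∑ j, ⟪h i, φ (star (a i) * a j) (h j)⟫_ℂ

namespace IsCP

variable {φ ψ : (H →L[ℂ] H) →ₗ[ℂ] (H →L[ℂ] H)}

lemma inner_nonneg (hφ : IsCP φ) (a : H →L[ℂ] H) (h : H) : 0 ≤ ⟪h, φ (star a * a) h⟫_ℂ := by
  simpa using hφ 1 ![a] ![h]

lemma pairing_map_nonneg (hφ : IsCP φ) {n : ℕ} {M : CStarMatrix (Fin n) (Fin n) (H →L[ℂ] H)}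
    (hM : 0 ≤ M) (h : Fin n → H) : 0 ≤ pairing h (act (M.map φ) h) := by
  obtain ⟨B, rfl⟩ := exists_eq_star_mul_self hM
  have : pairing h (act ((star B * B).map φ) h) =
      ∑ k, ∑ i, ∑ j, ⟪h i, φ (star (B k i) * B k j) (h j)⟫_ℂ := by
    simp only [pairing_act, CStarMatrix.map_apply, CStarMatrix.mul_apply, CStarMatrix.star_apply,
      map_sum, sum_apply, inner_sum]
    rw [Finset.sum_comm]
    conv_rhs => rw [Finset.sum_comm]; enter [2, i]; rw [Finset.sum_comm]
    rw [Finset.sum_comm]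
  rw [this]
  exact Finset.sum_nonneg fun k _ ↦ hφ n _ h

protected lemma id : IsCP (LinearMap.id : (H →L[ℂ] H) →ₗ[ℂ] (H →L[ℂ] H)) := by
  intro n a h
  have : ∑ i, ∑ j, ⟪h i, (star (a i) * a j) (h j)⟫_ℂ =
      ⟪∑ i, a i (h i), ∑ i, a i (h i)⟫_ℂ := by
    simp only [sum_inner, mul_apply_eq_comp, inner_star_apply, inner_sum]
    exact Finset.sum_comm
  simp only [LinearMap.id_apply, this, inner_self_eq_norm_sq_to_K, Complex.coe_algebraMap]
  exact_mod_cast sq_nonneg ‖∑ i, a i (h i)‖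

lemma comp (hφ : IsCP φ) (hψ : IsCP ψ) : IsCP (φ ∘ₗ ψ) := by
  intro n a h
  let M : CStarMatrix (Fin n) (Fin n) (H →L[ℂ] H) :=
    CStarMatrix.ofMatrix (Matrix.of fun i j ↦ ψ (star (a i) * a j))
  have hM : 0 ≤ M := nonneg_of_pairing fun k ↦ by
    rw [pairing_act]
    exact hψ n a k
  have := hφ.pairing_map_nonneg hM h
  rwa [pairing_act] at this

lemma add (hφ : IsCP φ) (hψ : IsCP ψ) : IsCP (φ + ψ) := by
  intro n a h
  have := add_nonneg (hφ n a h) (hψ n a h)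
  simpa [← Finset.sum_add_distrib, inner_add_right] using this

lemma smul (hφ : IsCP φ) {r : ℝ} (hr : 0 ≤ r) : IsCP ((r : ℂ) • φ) := by
  intro n a h
  have := mul_nonneg (a := (r : ℂ)) (by exact_mod_cast hr) (hφ n a h)
  simpa [Finset.mul_sum, inner_smul_right] using this

lemma map_star (hφ : IsCP φ) (b : H →L[ℂ] H) : φ (star b) = star (φ b) := by
  have key : ∀ h k : H, (⟪h, φ b k⟫_ℂ + ⟪k, φ (star b) h⟫_ℂ).im = 0 := by
    intro h k
    have h1 := (Complex.nonneg_iff.1 (hφ 2 ![1, b] ![h, k])).2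
    have h2 := (Complex.nonneg_iff.1 (hφ.inner_nonneg 1 h)).2
    have h3 := (Complex.nonneg_iff.1 (hφ.inner_nonneg b k)).2
    simp [Fin.sum_univ_two] at h1 h2 h3
    simp only [Complex.add_im]
    linarith
  ext h
  refine ext_inner_left ℂ fun k ↦ ?_
  rw [inner_star_apply, ← inner_conj_symm (φ b k)]
  have h1 := key h k
  have h2 := key (Complex.I • h) k
  simp at h1 h2
  apply Complex.ext
  · rw [Complex.conj_re]
    linarith
  · rw [Complex.conj_im]
    linarith

/-- The Kadison-Schwarz inequality for rows of operators. -/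
lemma schwarz (hφ : IsCP φ) (h1 : ∀ h, ⟪h, φ 1 h⟫_ℂ ≤ ⟪h, h⟫_ℂ) {n : ℕ}
    (a : Fin n → H →L[ℂ] H) (h : Fin n → H) :
    ⟪∑ j, φ (a j) (h j), ∑ j, φ (a j) (h j)⟫_ℂ ≤
      ∑ i, ∑ j, ⟪h i, φ (star (a i) * a j) (h j)⟫_ℂ := by
  set g := ∑ j, φ (a j) (h j) with hg
  have key := hφ (n + 1) (Fin.cons 1 a) (Fin.cons (-g) h)
  have e1 : ∑ j, ⟪g, φ (a j) (h j)⟫_ℂ = ⟪g, g⟫_ℂ := by rw [← inner_sum, ← hg]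
  have e2 : ∑ i, ⟪h i, φ (star (a i)) g⟫_ℂ = ⟪g, g⟫_ℂ := by
    simp only [hφ.map_star, inner_star_apply]
    rw [← sum_inner, ← hg]
  simp only [Fin.sum_univ_succ, Fin.cons_zero, Fin.cons_succ, star_one, one_mul, mul_one,
    inner_neg_left, inner_neg_right, map_neg, Finset.sum_add_distrib,
    Finset.sum_neg_distrib, e1, e2] at key
  rw [← sub_nonneg]
  have := add_nonneg key (sub_nonneg.2 (h1 g))
  convert this using 1
  ring

lemma inner_map_self_le (hφ : IsCP φ) (h1 : ∀ h, ⟪h, φ 1 h⟫_ℂ ≤ ⟪h, h⟫_ℂ)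
    (a : H →L[ℂ] H) (h : H) : ⟪φ a h, φ a h⟫_ℂ ≤ ⟪h, φ (star a * a) h⟫_ℂ := by
  simpa using hφ.schwarz h1 ![a] ![h]

lemma norm_map_le (hφ : IsCP φ) (h1 : ∀ h, ⟪h, φ 1 h⟫_ℂ ≤ ⟪h, h⟫_ℂ) (a : H →L[ℂ] H) :
    ‖φ a‖ ≤ ‖a‖ := by
  refine ContinuousLinearMap.opNorm_le_bound _ (norm_nonneg a) fun h ↦ ?_
  obtain ⟨c, hc⟩ := exists_eq_star_mul_self
    (sub_nonneg.2 ((star_mul_self_le_iff (norm_nonneg a)).2 le_rfl))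
  have h2 := hφ.inner_nonneg c h
  rw [← hc, map_sub, map_smul, sub_apply, inner_sub_right, sub_nonneg, smul_apply,
    inner_smul_right] at h2
  have h3 := (hφ.inner_map_self_le h1 a h).trans (h2.trans
    (mul_le_mul_of_nonneg_left (h1 h) (by exact_mod_cast sq_nonneg ‖a‖)))
  rw [inner_self_eq_norm_sq_to_K, inner_self_eq_norm_sq_to_K] at h3
  have h4 : ‖φ a h‖ ^ 2 ≤ ‖a‖ ^ 2 * ‖h‖ ^ 2 := by
    simp only [Complex.coe_algebraMap] at h3
    exact_mod_cast h3
  rw [← mul_pow] at h4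
  exact (sq_le_sq₀ (norm_nonneg _) (by positivity)).1 h4

lemma norm_map_matrix_le (hφ : IsCP φ) (h1 : φ 1 = 1) {n : ℕ}
    (M : CStarMatrix (Fin n) (Fin n) (H →L[ℂ] H)) : ‖M.map φ‖ ≤ ‖M‖ := by
  refine norm_le_of_pairing (norm_nonneg M) fun h ↦ ?_
  have e1 : (((‖M‖ ^ 2 : ℝ) : ℂ) • (1 : CStarMatrix (Fin n) (Fin n) (H →L[ℂ] H))
      - star M * M).map φ = ((‖M‖ ^ 2 : ℝ) : ℂ) • (1 : CStarMatrix (Fin n) (Fin n) (H →L[ℂ] H))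
      - (star M * M).map φ := by
    ext1 i j
    simp only [CStarMatrix.map_apply, CStarMatrix.sub_apply, CStarMatrix.smul_apply, map_sub,
      map_smul, CStarMatrix.one_apply]
    split_ifs <;> simp [h1]
  have key := hφ.pairing_map_nonneg (sub_star_mul_self_nonneg M) h
  rw [e1, act_sub, pairing_sub, act_smul, act_one, pairing_smul, sub_nonneg] at key
  refine le_trans ?_ key
  have e2 : pairing h (act ((star M * M).map φ) h) =
      ∑ k, ∑ i, ∑ j, ⟪h i, φ (star (M k i) * M k j) (h j)⟫_ℂ := by
    simp only [pairing_act, CStarMatrix.map_apply, CStarMatrix.mul_apply, CStarMatrix.star_apply,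
      map_sum, sum_apply, inner_sum]
    conv_rhs => rw [Finset.sum_comm]; enter [2, i]; rw [Finset.sum_comm]
  rw [e2]
  exact Finset.sum_le_sum fun k _ ↦ hφ.schwarz (by simp [h1]) _ h

end IsCP

end

end Silov

namespace Silov
open scoped ComplexOrder InnerProductSpace
open Filter Topology

section

variable {B : Type*} [CStarAlgebra B] [PartialOrder B] [StarOrderedRing B]

omit [PartialOrder B] [StarOrderedRing B] in
lemma im_eq_zero_of_norm_le {F : B →ₗ[ℂ] ℂ} {c : ℝ} (hc : 0 < c) (hF : ∀ b, ‖F b‖ ≤ c * ‖b‖)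
    (h1 : F 1 = c) {b : B} (hb : IsSelfAdjoint b) : (F b).im = 0 := by
  have key : ∀ t : ℝ, (F b).im ^ 2 + 2 * (F b).im * c * t ≤ c ^ 2 * ‖b‖ ^ 2 := by
    intro t
    set d := b + ((t : ℂ) * Complex.I) • (1 : B) with hd
    have hdd : star d * d = b * b + ((t ^ 2 : ℝ) : ℂ) • (1 : B) := by
      rw [hd, star_add, star_smul, star_one, hb.star_eq]
      simp only [add_mul, mul_add, smul_mul_assoc, mul_smul_comm, one_mul, mul_one,
        star_mul', RCLike.star_def, Complex.conj_I, Complex.conj_ofReal]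
      have h2 : (t : ℂ) * Complex.I * (t * -Complex.I) = ((t ^ 2 : ℝ) : ℂ) := by
        push_cast
        linear_combination (-(t : ℂ) ^ 2) * Complex.I_mul_I
      rw [smul_add, smul_smul, h2, mul_neg, neg_smul]
      abel
    have hn1 : ‖(1 : B)‖ ≤ 1 := by
      rcases subsingleton_or_nontrivial B with h | h
      · rw [Subsingleton.elim (1 : B) 0, norm_zero]
        exact zero_le_one
      · exact CStarRing.norm_one.le
    have hn : ‖d‖ ^ 2 ≤ ‖b‖ ^ 2 + t ^ 2 := by
      rw [sq ‖d‖, ← CStarRing.norm_star_mul_self, hdd]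
      refine (norm_add_le _ _).trans (add_le_add ((norm_mul_le _ _).trans (sq _).ge) ?_)
      rw [norm_smul, Complex.norm_real, Real.norm_of_nonneg (sq_nonneg t)]
      exact mul_le_of_le_one_right (sq_nonneg t) hn1
    have hFd : (F d).im = (F b).im + c * t := by
      simp [hd, h1, mul_comm]
    have h3 : |(F d).im| ≤ c * ‖d‖ := (Complex.abs_im_le_norm _).trans (hF d)
    have h4 : (F d).im ^ 2 ≤ c ^ 2 * ‖d‖ ^ 2 := by
      rw [← mul_pow, ← sq_abs]
      exact pow_le_pow_left₀ (abs_nonneg _) h3 2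
    rw [hFd] at h4
    have h5 := mul_le_mul_of_nonneg_left hn (sq_nonneg c)
    nlinarith
  by_contra h0
  have := key (c ^ 2 * ‖b‖ ^ 2 / (2 * (F b).im * c))
  rw [mul_div_cancel₀ _ (by positivity)] at this
  have : 0 < (F b).im ^ 2 := by positivity
  linarith

/-- A functional attaining its norm at the unit is positive. -/
lemma nonneg_of_norm_le {F : B →ₗ[ℂ] ℂ} {c : ℝ} (hc : 0 ≤ c) (hF : ∀ b, ‖F b‖ ≤ c * ‖b‖)
    (h1 : F 1 = c) {b : B} (hb : 0 ≤ b) : 0 ≤ F b := by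
  rcases hc.eq_or_lt with rfl | hc
  · have : F b = 0 := by simpa using hF b
    exact this.ge
  refine Complex.nonneg_iff.2 ⟨?_, (im_eq_zero_of_norm_le hc hF h1 hb.isSelfAdjoint).symm⟩
  have hle : b ≤ (‖b‖ : ℂ) • (1 : B) := by
    rw [Complex.coe_smul, ← Algebra.algebraMap_eq_smul_one]
    exact (CStarAlgebra.norm_le_iff_le_algebraMap b (norm_nonneg b) hb).1 le_rfl
  have hn : ‖(‖b‖ : ℂ) • (1 : B) - b‖ ≤ ‖b‖ := by
    refine (CStarAlgebra.norm_le_iff_le_algebraMap _ (norm_nonneg b) (sub_nonneg.2 hle)).2 ?_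
    rw [Algebra.algebraMap_eq_smul_one, ← Complex.coe_smul]
    exact sub_le_self _ hb
  have h2 := (Complex.re_le_norm _).trans ((hF _).trans (mul_le_mul_of_nonneg_left hn hc.le))
  simp [h1] at h2
  nlinarith

end

lemma exists_extension_vanishing {E : Type*} [NormedAddCommGroup E] [NormedSpace ℂ E]
    {p q : Submodule ℂ E} (h : ∀ x ∈ p, ∀ v ∈ q, ‖x‖ ≤ ‖x + v‖) {g : E →ₗ[ℂ] ℂ} {c : ℝ}
    (hc : 0 ≤ c) (hg : ∀ x, ‖g x‖ ≤ c * ‖x‖) :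
    ∃ F : E →ₗ[ℂ] ℂ, (∀ x ∈ p, F x = g x) ∧ (∀ v ∈ q, F v = 0) ∧ ∀ x, ‖F x‖ ≤ c * ‖x‖ := by
  let f₁ : E →ₗ.[ℂ] ℂ := ⟨p, g.domRestrict p⟩
  let f₂ : E →ₗ.[ℂ] ℂ := ⟨q, 0⟩
  have H : ∀ (x : f₁.domain) (y : f₂.domain), (x : E) = y → f₁ x = f₂ y := by
    intro x y hxy
    have h0 := h x x.2 (-y) (q.neg_mem y.2)
    rw [hxy, add_neg_cancel, norm_zero, norm_le_zero_iff] at h0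
    change g x = 0
    rw [hxy, h0, map_zero]
  have hsup : ∀ (x v : E) (hx : x ∈ p) (hv : v ∈ q) (z : ↥(f₁.domain ⊔ f₂.domain)),
      x + v = z → f₁.sup f₂ H z = g x := by
    intro x v hx hv z hz
    rw [LinearPMap.sup_apply H ⟨x, hx⟩ ⟨v, hv⟩ z hz]
    exact add_zero _
  have hbound : ∀ z : ↥(f₁.domain ⊔ f₂.domain), ‖f₁.sup f₂ H z‖ ≤ c * ‖z‖ := by
    intro z
    obtain ⟨x, hx, v, hv, hz⟩ := Submodule.mem_sup.1 z.2
    rw [hsup x v hx hv z hz]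
    refine (hg x).trans (mul_le_mul_of_nonneg_left ?_ hc)
    rw [Submodule.coe_norm, ← hz]
    exact h x hx v hv
  obtain ⟨F, hF, hn⟩ := exists_extension_norm_eq (f₁.domain ⊔ f₂.domain)
    ((f₁.sup f₂ H).toFun.mkContinuous c hbound)
  refine ⟨F, fun x hx ↦ ?_, fun v hv ↦ ?_, fun x ↦ ?_⟩
  · exact (hF ⟨x, Submodule.mem_sup_left hx⟩).trans (hsup x 0 hx q.zero_mem _ (add_zero x))
  · refine (hF ⟨v, Submodule.mem_sup_right hv⟩).trans ?_
    exact (hsup 0 v p.zero_mem hv _ (zero_add v)).trans (map_zero g)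
  · refine F.le_of_opNorm_le ?_ x
    rw [hn]
    exact LinearMap.mkContinuous_norm_le _ hc _

section

variable {H : Type*} [NormedAddCommGroup H] [InnerProductSpace ℂ H]

lemma exists_entries {n : ℕ} (F : CStarMatrix (Fin n) (Fin n) (H →L[ℂ] H) →ₗ[ℂ] ℂ) :
    ∃ G : Fin n → Fin n → (H →L[ℂ] H) →ₗ[ℂ] ℂ,
      (∀ i j a, G i j a = F (CStarMatrix.ofMatrix (Matrix.single i j a))) ∧
      ∀ M, F M = ∑ i, ∑ j, G i j (M i j) := by
  refine ⟨fun i j ↦ F ∘ₗ (CStarMatrix.ofMatrixₗ (R := ℂ)).toLinearMap ∘ₗ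
    Matrix.singleLinearMap ℂ i j, fun i j a ↦ rfl, fun M ↦ ?_⟩
  conv_lhs => rw [show M = CStarMatrix.ofMatrixₗ (R := ℂ) (CStarMatrix.ofMatrix.symm M) from rfl,
    Matrix.matrix_eq_sum_single (CStarMatrix.ofMatrix.symm M)]
  simp only [map_sum]
  rfl

variable [CompleteSpace H]

lemma QuotientCompletelyIsometricOn.norm_le {A : Type*} [CStarAlgebra A] [PartialOrder A]
    [StarOrderedRing A] {X V : Submodule ℂ A} (h : QuotientCompletelyIsometricOn X V) {n : ℕ}
    {x v : CStarMatrix (Fin n) (Fin n) A} (hx : x ∈ matrixSubspace n X)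
    (hv : v ∈ matrixSubspace n V) : ‖x‖ ≤ ‖x + v‖ := by
  rw [← h n x hx]
  have : (matrixSubspace n V).mkQ x = Submodule.Quotient.mk (x + v) :=
    (Submodule.Quotient.eq _).2 (by simpa using (matrixSubspace n V).neg_mem hv)
  rw [this]
  exact Submodule.Quotient.norm_mk_le _ _

lemma quotientCompletelyIsometricOn_of_norm_le {A : Type*} [CStarAlgebra A] [PartialOrder A]
    [StarOrderedRing A] {X V : Submodule ℂ A}
    (h : ∀ (n : ℕ), ∀ x ∈ matrixSubspace n X, ∀ v ∈ matrixSubspace n V, ‖x‖ ≤ ‖x + v‖) :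
    QuotientCompletelyIsometricOn X V := by
  refine fun n x hx ↦ le_antisymm (Submodule.Quotient.norm_mk_le _ _) ?_
  refine le_of_forall_pos_le_add fun ε hε ↦ ?_
  obtain ⟨m, hm, hlt⟩ := Submodule.Quotient.norm_mk_lt ((matrixSubspace n V).mkQ x) hε
  have := h n x hx (m - x) ((Submodule.Quotient.eq _).1 hm)
  rw [add_sub_cancel] at this
  exact this.trans hlt.le

lemma norm_pairing_act_le {n : ℕ} {e : Fin n → H} (he : ∀ i, ‖e i‖ = 1)
    (M : CStarMatrix (Fin n) (Fin n) (H →L[ℂ] H)) : ‖pairing e (act M e)‖ ≤ n * ‖M‖ := by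
  have h1 : ‖pairing e (act M e)‖ ≤ ∑ i, ‖act M e i‖ := by
    refine (norm_sum_le _ _).trans (Finset.sum_le_sum fun i _ ↦ ?_)
    simpa [he] using norm_inner_le_norm (𝕜 := ℂ) (e i) (act M e i)
  have h2 : ∑ i, ‖act M e i‖ ^ 2 ≤ ‖M‖ ^ 2 * n := by
    have := pairing_act_self_le M e
    rw [pairing_self, pairing_self] at this
    have h3 : ∑ i, ‖act M e i‖ ^ 2 ≤ ‖M‖ ^ 2 * ∑ i, ‖e i‖ ^ 2 := by exact_mod_cast this
    simpa [he] using h3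
  have h3 := sq_sum_le_card_mul_sum_sq (s := Finset.univ) (f := fun i ↦ ‖act M e i‖)
  rw [Finset.card_univ, Fintype.card_fin] at h3
  refine h1.trans (abs_le_of_sq_le_sq' ?_ (by positivity)).2
  refine h3.trans ((mul_le_mul_of_nonneg_left h2 (Nat.cast_nonneg n)).trans_eq (by ring))

/-- A positive functional on operator matrices induces a completely positive map into the
operators on the span of a finite family of vectors. -/
lemma exists_isCP_of_functional {n : ℕ} (e : Fin n → H)
    (G : Fin n → Fin n → (H →L[ℂ] H) →ₗ[ℂ] ℂ)
    (hG : ∀ M : CStarMatrix (Fin n) (Fin n) (H →L[ℂ] H), 0 ≤ M → 0 ≤ ∑ i, ∑ j, G i j (M i j)) :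
    ∃ ψ : (H →L[ℂ] H) →ₗ[ℂ] (H →L[ℂ] H), IsCP ψ ∧
      ∀ a h k, ⟪h, ψ a k⟫_ℂ = ∑ i, ∑ j, G i j a * (⟪h, e i⟫_ℂ * ⟪e j, k⟫_ℂ) := by
  let ψ : (H →L[ℂ] H) →ₗ[ℂ] (H →L[ℂ] H) :=
    ∑ i, ∑ j, (G i j).smulRight (InnerProductSpace.rankOne ℂ (e i) (e j))
  have hψ : ∀ a h k, ⟪h, ψ a k⟫_ℂ = ∑ i, ∑ j, G i j a * (⟪h, e i⟫_ℂ * ⟪e j, k⟫_ℂ) := by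
    intro a h k
    simp only [ψ, LinearMap.sum_apply, sum_apply, inner_sum, LinearMap.smulRight_apply,
      smul_apply, InnerProductSpace.rankOne_apply, inner_smul_right]
    exact Finset.sum_congr rfl fun i _ ↦ Finset.sum_congr rfl fun j _ ↦ by ring
  refine ⟨ψ, fun m a h ↦ ?_, hψ⟩
  let b : Fin n → H →L[ℂ] H := fun j ↦ ∑ l, ⟪e j, h l⟫_ℂ • a l
  have hM : 0 ≤ (CStarMatrix.ofMatrix (Matrix.of fun i j ↦ star (b i) * b j) :
      CStarMatrix (Fin n) (Fin n) (H →L[ℂ] H)) := nonneg_of_pairing fun k ↦ by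
    rw [pairing_act]
    exact IsCP.id n b k
  have key := hG _ hM
  have hentry : ∀ i j, (CStarMatrix.ofMatrix (Matrix.of fun i j ↦ star (b i) * b j) :
      CStarMatrix (Fin n) (Fin n) (H →L[ℂ] H)) i j =
      ∑ k, ∑ l, (⟪h k, e i⟫_ℂ * ⟪e j, h l⟫_ℂ) • (star (a k) * a l) := by
    intro i j
    change star (b i) * b j = _
    simp only [b, star_sum, star_smul, RCLike.star_def, inner_conj_symm, Finset.sum_mul_sum,
      smul_mul_assoc, mul_smul_comm, smul_smul]
    exact Finset.sum_congr rfl fun k _ ↦ Finset.sum_congr rfl fun l _ ↦ by rw [mul_comm]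
  simp only [hentry, map_sum, map_smul, smul_eq_mul] at key
  convert key using 1
  simp only [hψ]
  calc _ = ∑ k, ∑ i, ∑ j, ∑ l, G i j (star (a k) * a l) * (⟪h k, e i⟫_ℂ * ⟪e j, h l⟫_ℂ) := by
        refine Finset.sum_congr rfl fun k _ ↦ ?_
        rw [Finset.sum_comm]
        exact Finset.sum_congr rfl fun i _ ↦ Finset.sum_comm
    _ = _ := by
        rw [Finset.sum_comm]
        refine Finset.sum_congr rfl fun i _ ↦ ?_
        rw [Finset.sum_comm]
        exact Finset.sum_congr rfl fun j _ ↦ Finset.sum_congr rfl fun k _ ↦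
          Finset.sum_congr rfl fun l _ ↦ mul_comm _ _

lemma exists_isCP_compression {X V : Submodule ℂ (H →L[ℂ] H)} (hX : 1 ∈ X)
    (hV : QuotientCompletelyIsometricOn X V) (s : Finset H) :
    ∃ ψ : (H →L[ℂ] H) →ₗ[ℂ] (H →L[ℂ] H), IsCP ψ ∧ (∀ h, ⟪h, ψ 1 h⟫_ℂ ≤ ⟪h, h⟫_ℂ) ∧
      (∀ v ∈ V, ψ v = 0) ∧ ∀ x ∈ X, ∀ h ∈ s, ∀ k ∈ s, ⟪h, ψ x k⟫_ℂ = ⟪h, x k⟫_ℂ := by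
  let S := Submodule.span ℂ (s : Set H)
  let b := stdOrthonormalBasis ℂ S
  let n := Module.finrank ℂ S
  let e : Fin n → H := fun i ↦ (b i : H)
  have heo : Orthonormal ℂ e := b.orthonormal.comp_linearIsometry S.subtypeₗᵢ
  let g : CStarMatrix (Fin n) (Fin n) (H →L[ℂ] H) →ₗ[ℂ] ℂ :=
    { toFun := fun M ↦ pairing e (act M e)
      map_add' := fun M N ↦ by simp [pairing_act, Finset.sum_add_distrib]
      map_smul' := fun c M ↦ by rw [act_smul, pairing_smul]; rfl }
  have hg1 : g 1 = (n : ℝ) := by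
    change pairing e (act 1 e) = _
    rw [act_one, pairing_self]
    simp [heo.1]
  obtain ⟨F, hFX, hFV, hF⟩ := exists_extension_vanishing
    (p := matrixSubspace n X) (q := matrixSubspace n V)
    (fun x hx v hv ↦ hV.norm_le hx hv) (g := g) (Nat.cast_nonneg n) (norm_pairing_act_le heo.1)
  have hF1 : F 1 = (n : ℝ) := by
    rw [← hg1]
    refine hFX 1 fun i j ↦ ?_
    rw [CStarMatrix.one_apply]
    split_ifs
    exacts [hX, X.zero_mem]
  obtain ⟨G, hGF, hG⟩ := exists_entries F
  have hsingle : ∀ (W : Submodule ℂ (H →L[ℂ] H)) (w) (_ : w ∈ W) (i j : Fin n),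
      CStarMatrix.ofMatrix (Matrix.single i j w) ∈ matrixSubspace n W := by
    intro W w hw i j k l
    change Matrix.single i j w k l ∈ W
    rw [Matrix.single_apply]
    split_ifs
    exacts [hw, W.zero_mem]
  obtain ⟨ψ, hψ, hin⟩ := exists_isCP_of_functional e G fun M hM ↦ by
    rw [← hG]
    exact nonneg_of_norm_le (Nat.cast_nonneg n) hF hF1 hM
  have hGX : ∀ x ∈ X, ∀ i j, G i j x = ⟪e i, x (e j)⟫_ℂ := by
    intro x hx i j
    rw [hGF, hFX _ (hsingle X x hx i j)]
    change pairing e (act _ e) = _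
    rw [pairing_act, Finset.sum_eq_single i, Finset.sum_eq_single j]
    · simp
    · intro l _ hl
      simp [hl.symm]
    · simp
    · intro l _ hl
      simp [hl.symm]
    · simp
  have hin' : ∀ x ∈ X, ∀ h k, ⟪h, ψ x k⟫_ℂ =
      ⟪∑ i, ⟪e i, h⟫_ℂ • e i, x (∑ j, ⟪e j, k⟫_ℂ • e j)⟫_ℂ := by
    intro x hx h k
    simp only [hin, hGX x hx, map_sum, map_smul, sum_inner, inner_sum, inner_smul_left,
      inner_smul_right, inner_conj_symm, Finset.mul_sum]
    rw [Finset.sum_comm]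
    exact Finset.sum_congr rfl fun i _ ↦ Finset.sum_congr rfl fun j _ ↦ by ring
  refine ⟨ψ, hψ, fun h ↦ ?_, fun v hv ↦ ?_, fun x hx h hh k hk ↦ ?_⟩
  · rw [hin' 1 hX]
    have h1 := heo.inner_sum (fun i ↦ ⟪e i, h⟫_ℂ) (fun i ↦ ⟪e i, h⟫_ℂ) Finset.univ
    change ⟪∑ i, ⟪e i, h⟫_ℂ • e i, ∑ i, ⟪e i, h⟫_ℂ • e i⟫_ℂ ≤ _
    rw [h1, inner_self_eq_norm_sq_to_K]
    have h2 := heo.sum_inner_products_le h (s := Finset.univ)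
    simp only [RCLike.conj_mul, Complex.coe_algebraMap]
    exact_mod_cast h2
  · ext k
    refine ext_inner_left ℂ fun h ↦ ?_
    simp only [hin, hGF]
    simp [hFV _ (hsingle V v hv _ _)]
  · have hrep : ∀ y ∈ s, ∑ i, ⟪e i, y⟫_ℂ • e i = y := by
      intro y hy
      have := congrArg S.subtype (b.sum_repr' ⟨y, Submodule.subset_span hy⟩)
      simpa using this
    rw [hin' x hx, hrep h hh, hrep k hk]

end

end Silov

namespace Silov
open scoped ComplexOrder InnerProductSpace
open Filter Topology

section

variable {H : Type*} [NormedAddCommGroup H] [InnerProductSpace ℂ H] [CompleteSpace H]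

lemma exists_weak_ultralimit {ι : Type*} (U : Ultrafilter ι) {T : ι → H →L[ℂ] H} {C : ℝ}
    (hT : ∀ i, ‖T i‖ ≤ C) :
    ∃ S : H →L[ℂ] H, ∀ h k, Tendsto (fun i ↦ ⟪h, T i k⟫_ℂ) U (𝓝 ⟪h, S k⟫_ℂ) := by
  have hb : ∀ h k i, ‖⟪h, T i k⟫_ℂ‖ ≤ C * ‖h‖ * ‖k‖ := fun h k i ↦ calc
    ‖⟪h, T i k⟫_ℂ‖ ≤ ‖h‖ * ‖T i k‖ := norm_inner_le_norm _ _
    _ ≤ ‖h‖ * (C * ‖k‖) := by gcongr; exact (T i).le_of_opNorm_le (hT i) k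
    _ = C * ‖h‖ * ‖k‖ := by ring
  have hlim : ∀ h k, ∃ z : ℂ, Tendsto (fun i ↦ ⟪h, T i k⟫_ℂ) U (𝓝 z) := by
    intro h k
    obtain ⟨z, -, hz⟩ := (isCompact_closedBall (0 : ℂ) (C * ‖h‖ * ‖k‖)).ultrafilter_le_nhds
      (U.map fun i ↦ ⟪h, T i k⟫_ℂ) (by
        rw [le_principal_iff]
        exact Filter.mem_map.2 (Eventually.of_forall fun i ↦ by simpa using hb h k i))
    exact ⟨z, hz⟩
  choose L hL using hlim
  let B : H →ₗ⋆[ℂ] H →ₗ[ℂ] ℂ := LinearMap.mk₂'ₛₗ _ _ L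
    (fun h h' k ↦ tendsto_nhds_unique (hL _ _)
      (by simpa only [inner_add_left] using (hL h k).add (hL h' k)))
    (fun c h k ↦ tendsto_nhds_unique (hL _ _)
      (by simpa only [inner_smul_left, smul_eq_mul] using (hL h k).const_mul (starRingEnd ℂ c)))
    (fun h k k' ↦ tendsto_nhds_unique (hL _ _)
      (by simpa only [map_add, inner_add_right] using (hL h k).add (hL h k')))
    (fun c h k ↦ tendsto_nhds_unique (hL _ _)
      (by simpa only [map_smul, inner_smul_right, smul_eq_mul, RingHom.id_apply] using (hL h k).const_mul c))
  let B' : H →L⋆[ℂ] H →L[ℂ] ℂ := B.mkContinuous₂ C fun h k ↦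
    le_of_tendsto (hL h k).norm (Eventually.of_forall (hb h k))
  refine ⟨star (InnerProductSpace.continuousLinearMapOfBilin B'), fun h k ↦ ?_⟩
  rw [inner_star_apply, InnerProductSpace.continuousLinearMapOfBilin_apply]
  exact hL h k

omit [CompleteSpace H] in
lemma norm_le_of_weak_tendsto {ι : Type*} {l : Filter ι} [l.NeBot] {T : ι → H →L[ℂ] H}
    {S : H →L[ℂ] H} {C : ℝ} (hC : 0 ≤ C) (hT : ∀ᶠ i in l, ‖T i‖ ≤ C)
    (hS : ∀ h k, Tendsto (fun i ↦ ⟪h, T i k⟫_ℂ) l (𝓝 ⟪h, S k⟫_ℂ)) : ‖S‖ ≤ C := by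
  refine S.opNorm_le_bound hC fun k ↦ ?_
  have h1 : ‖⟪S k, S k⟫_ℂ‖ ≤ ‖S k‖ * (C * ‖k‖) :=
    le_of_tendsto (hS (S k) k).norm (hT.mono fun i hi ↦ (norm_inner_le_norm _ _).trans
      (mul_le_mul_of_nonneg_left ((T i).le_of_opNorm_le hi k) (norm_nonneg _)))
  rw [inner_self_eq_norm_sq_to_K, norm_pow, RCLike.norm_ofReal, abs_norm, sq] at h1
  rcases (norm_nonneg (S k)).eq_or_lt with h0 | h0
  · rw [← h0]
    positivity
  · exact le_of_mul_le_mul_left h1 h0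

lemma exists_ultralimit {ι : Type*} (U : Ultrafilter ι)
    {ψ : ι → (H →L[ℂ] H) →ₗ[ℂ] (H →L[ℂ] H)} (hψ : ∀ i a, ‖ψ i a‖ ≤ ‖a‖) :
    ∃ φ : (H →L[ℂ] H) →ₗ[ℂ] (H →L[ℂ] H),
      ∀ a h k, Tendsto (fun i ↦ ⟪h, ψ i a k⟫_ℂ) U (𝓝 ⟪h, φ a k⟫_ℂ) := by
  choose φ hφ using fun a ↦ exists_weak_ultralimit U (T := fun i ↦ ψ i a) fun i ↦ hψ i a
  refine ⟨{ toFun := φ, map_add' := fun a b ↦ ?_, map_smul' := fun c a ↦ ?_ }, hφ⟩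
  · refine ContinuousLinearMap.ext fun k ↦ ext_inner_left ℂ fun h ↦
      tendsto_nhds_unique (hφ _ h k) ?_
    simpa only [map_add, add_apply, inner_add_right] using (hφ a h k).add (hφ b h k)
  · refine ContinuousLinearMap.ext fun k ↦ ext_inner_left ℂ fun h ↦
      tendsto_nhds_unique (hφ _ h k) ?_
    simpa only [map_smul, smul_apply, inner_smul_right, RingHom.id_apply] using
      (hφ a h k).const_mul c

lemma isCP_of_tendsto {ι : Type*} {l : Filter ι} [l.NeBot]
    {ψ : ι → (H →L[ℂ] H) →ₗ[ℂ] (H →L[ℂ] H)} {φ : (H →L[ℂ] H) →ₗ[ℂ] (H →L[ℂ] H)}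
    (hψ : ∀ i, IsCP (ψ i))
    (hφ : ∀ a h k, Tendsto (fun i ↦ ⟪h, ψ i a k⟫_ℂ) l (𝓝 ⟪h, φ a k⟫_ℂ)) : IsCP φ :=
  fun n a h ↦ ge_of_tendsto' (tendsto_finsetSum _ fun i _ ↦ tendsto_finsetSum _ fun j _ ↦
    hφ (star (a i) * a j) (h i) (h j)) fun m ↦ hψ m n a h

/-- `φ` is a completely positive map on `B(H)` which fixes every element of `X`. -/
structure IsCPFixing (X : Submodule ℂ (H →L[ℂ] H)) (φ : (H →L[ℂ] H) →ₗ[ℂ] (H →L[ℂ] H)) :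
    Prop where
  isCP : IsCP φ
  map_eq : ∀ x ∈ X, φ x = x

/-- The extension theorem: if the quotient by `V` is completely isometric on `X`, then the
identity of `X` extends to a completely positive map on `B(H)` which vanishes on `V`. -/
lemma exists_isCPFixing_vanishing {X V : Submodule ℂ (H →L[ℂ] H)} (hX : 1 ∈ X)
    (hV : QuotientCompletelyIsometricOn X V) : ∃ ψ, IsCPFixing X ψ ∧ ∀ v ∈ V, ψ v = 0 := by
  choose ψ hψ h1 hψV hψX using exists_isCP_compression hX hV
  let U : Ultrafilter (Finset H) := Ultrafilter.of atTop
  obtain ⟨φ, hφ⟩ := exists_ultralimit U fun s a ↦ (hψ s).norm_map_le (h1 s) a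
  refine ⟨φ, ⟨isCP_of_tendsto hψ hφ, fun x hx ↦ ?_⟩, fun v hv ↦ ?_⟩
  · refine ContinuousLinearMap.ext fun k ↦ ext_inner_left ℂ fun h ↦
      tendsto_nhds_unique (hφ x h k) (tendsto_const_nhds.congr' ?_)
    classical
    have hs : ∀ᶠ s : Finset H in U, {h, k} ≤ s :=
      (eventually_ge_atTop {h, k}).filter_mono (Ultrafilter.of_le atTop)
    filter_upwards [hs] with s hs
    exact (hψX s x hx h (hs (by simp)) k (hs (by simp))).symm
  · refine ContinuousLinearMap.ext fun k ↦ ext_inner_left ℂ fun h ↦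
      tendsto_nhds_unique (hφ v h k) ?_
    simp [hψV _ v hv]

namespace IsCPFixing

variable {X : Submodule ℂ (H →L[ℂ] H)} {φ ψ : (H →L[ℂ] H) →ₗ[ℂ] (H →L[ℂ] H)}

protected lemma id : IsCPFixing X LinearMap.id := ⟨IsCP.id, fun _ _ ↦ rfl⟩

lemma comp (hφ : IsCPFixing X φ) (hψ : IsCPFixing X ψ) : IsCPFixing X (φ ∘ₗ ψ) :=
  ⟨hφ.isCP.comp hψ.isCP, fun x hx ↦ by
    rw [LinearMap.comp_apply, hψ.map_eq x hx, hφ.map_eq x hx]⟩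

lemma norm_map_le (hX : 1 ∈ X) (hφ : IsCPFixing X φ) (a : H →L[ℂ] H) : ‖φ a‖ ≤ ‖a‖ :=
  hφ.isCP.norm_map_le (by simp [hφ.map_eq 1 hX]) a

lemma continuous (hX : 1 ∈ X) (hφ : IsCPFixing X φ) : Continuous φ :=
  (φ.mkContinuous 1 fun a ↦ by simpa using hφ.norm_map_le hX a).continuous

lemma iterate (hφ : IsCPFixing X φ) (n : ℕ) : IsCPFixing X (φ ^ n) := by
  induction n with
  | zero => exact IsCPFixing.id
  | succ n ih => rw [pow_succ]; exact ih.comp hφ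

/-- The Cesàro means of the iterates of `φ`. -/
lemma cesaro (hφ : IsCPFixing X φ) (n : ℕ) :
    IsCPFixing X ((((n + 1 : ℝ)⁻¹ : ℝ) : ℂ) • ∑ k ∈ Finset.range (n + 1), φ ^ k) := by
  refine ⟨IsCP.smul ?_ (by positivity), fun x hx ↦ ?_⟩
  · induction n with
    | zero => simpa using (hφ.iterate 0).isCP
    | succ n ih => rw [Finset.sum_range_succ]; exact ih.add (hφ.iterate _).isCP
  · have : ((n : ℂ) + 1) ≠ 0 := by exact_mod_cast n.succ_ne_zero
    simp only [LinearMap.smul_apply, LinearMap.sum_apply, (hφ.iterate _).map_eq x hx,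
      Finset.sum_const, Finset.card_range, ← Nat.cast_smul_eq_nsmul ℂ, smul_smul]
    push_cast
    rw [inv_mul_cancel₀ this, one_smul]

end IsCPFixing

/-- `φ` has a minimal seminorm `a ↦ ‖φ a‖` among the completely positive maps fixing `X`. -/
structure IsMinimalCPFixing (X : Submodule ℂ (H →L[ℂ] H))
    (φ : (H →L[ℂ] H) →ₗ[ℂ] (H →L[ℂ] H)) : Prop extends IsCPFixing X φ where
  minimal : ∀ ψ, IsCPFixing X ψ → (∀ a, ‖ψ a‖ ≤ ‖φ a‖) → ∀ a, ‖φ a‖ ≤ ‖ψ a‖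

lemma exists_isCPFixing_le {X : Submodule ℂ (H →L[ℂ] H)} (hX : 1 ∈ X) {ι : Type*} [Nonempty ι]
    {ψ : ι → (H →L[ℂ] H) →ₗ[ℂ] (H →L[ℂ] H)} (hψ : ∀ i, IsCPFixing X (ψ i))
    (hdir : Directed (fun φ θ ↦ ∀ a, ‖θ a‖ ≤ ‖φ a‖) ψ) :
    ∃ φ, IsCPFixing X φ ∧ ∀ i a, ‖φ a‖ ≤ ‖ψ i a‖ := by
  let S : ι → Set ι := fun i ↦ {j | ∀ a, ‖ψ j a‖ ≤ ‖ψ i a‖}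
  have hl : (⨅ i, 𝓟 (S i)).NeBot := by
    refine iInf_neBot_of_directed' (fun i j ↦ ?_) fun i ↦ ?_
    · obtain ⟨k, h1, h2⟩ := hdir i j
      exact ⟨k, principal_mono.2 fun _ h a ↦ (h a).trans (h1 a),
        principal_mono.2 fun _ h a ↦ (h a).trans (h2 a)⟩
    · exact principal_neBot_iff.2 ⟨i, fun a ↦ le_rfl⟩
  let U : Ultrafilter ι := Ultrafilter.of (⨅ i, 𝓟 (S i))
  obtain ⟨φ, hφ⟩ := exists_ultralimit U fun i ↦ (hψ i).norm_map_le hX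
  refine ⟨φ, ⟨isCP_of_tendsto (fun i ↦ (hψ i).isCP) hφ, fun x hx ↦ ?_⟩, fun i a ↦ ?_⟩
  · refine ContinuousLinearMap.ext fun k ↦ ext_inner_left ℂ fun h ↦
      tendsto_nhds_unique (hφ x h k) ?_
    simp [fun i ↦ (hψ i).map_eq x hx]
  · have hmem : ∀ᶠ j in (U : Filter ι), j ∈ S i :=
      (Ultrafilter.of_le _) (mem_iInf_of_mem i (mem_principal_self (S i)))
    exact norm_le_of_weak_tendsto (norm_nonneg _) (hmem.mono fun j hj ↦ hj a) (hφ a)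

lemma exists_isMinimalCPFixing {X : Submodule ℂ (H →L[ℂ] H)} (hX : 1 ∈ X) :
    ∃ φ, IsMinimalCPFixing X φ := by
  let K := {φ : (H →L[ℂ] H) →ₗ[ℂ] (H →L[ℂ] H) // IsCPFixing X φ}
  let r : K → K → Prop := fun φ ψ ↦ ∀ a, ‖ψ.1 a‖ ≤ ‖φ.1 a‖
  have hrefl : Std.Refl r := ⟨fun φ a ↦ le_rfl⟩
  have hbdd : ∀ c, IsChain r c → ∃ ub, ∀ φ ∈ c, r φ ub := by
    intro c hc
    rcases c.eq_empty_or_nonempty with rfl | ⟨φ₀, hφ₀⟩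
    · exact ⟨⟨LinearMap.id, IsCPFixing.id⟩, by simp⟩
    have : Nonempty c := ⟨⟨φ₀, hφ₀⟩⟩
    obtain ⟨φ, hφ, hle⟩ := exists_isCPFixing_le hX (ψ := fun φ : c ↦ φ.1.1) (fun φ ↦ φ.1.2)
      fun φ ψ ↦ by
        obtain ⟨θ, hθ, h1, h2⟩ := hc.directedOn φ φ.2 ψ ψ.2
        exact ⟨⟨θ, hθ⟩, h1, h2⟩
    exact ⟨⟨φ, hφ⟩, fun ψ hψ a ↦ hle ⟨ψ, hψ⟩ a⟩
  obtain ⟨φ, hφ⟩ := exists_maximal_of_chains_bounded hbdd fun h h' a ↦ (h' a).trans (h a)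
  exact ⟨φ.1, φ.2, fun ψ hψ h ↦ hφ ⟨ψ, hψ⟩ h⟩

namespace IsMinimalCPFixing

variable {X : Submodule ℂ (H →L[ℂ] H)} {φ ψ : (H →L[ℂ] H) →ₗ[ℂ] (H →L[ℂ] H)}

lemma norm_map_map (hX : 1 ∈ X) (hφ : IsMinimalCPFixing X φ) (hψ : IsCPFixing X ψ)
    (a : H →L[ℂ] H) : ‖ψ (φ a)‖ = ‖φ a‖ :=
  le_antisymm (hψ.norm_map_le hX _)
    (hφ.minimal (ψ ∘ₗ φ) (hψ.comp hφ.toIsCPFixing) (fun _ ↦ hψ.norm_map_le hX _) a)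

lemma comp_left (hX : 1 ∈ X) (hφ : IsMinimalCPFixing X φ) (hψ : IsCPFixing X ψ) :
    IsMinimalCPFixing X (ψ ∘ₗ φ) where
  toIsCPFixing := hψ.comp hφ.toIsCPFixing
  minimal θ hθ h a := by
    have h' : ∀ a, ‖(ψ ∘ₗ φ) a‖ = ‖φ a‖ := hφ.norm_map_map hX hψ
    simp only [h'] at h ⊢
    exact hφ.minimal θ hθ h a

lemma idempotent (hX : 1 ∈ X) (hφ : IsMinimalCPFixing X φ) (a : H →L[ℂ] H) :
    φ (φ a) = φ a := by
  have key : ∀ n : ℕ, ‖φ (a - φ a)‖ ≤ 2 * ‖a‖ * (1 / ((n : ℝ) + 1)) := by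
    intro n
    rw [← hφ.norm_map_map hX (hφ.toIsCPFixing.cesaro n)]
    have h1 : (∑ k ∈ Finset.range (n + 1), φ ^ k) (φ (a - φ a)) =
        φ a - (φ ^ (n + 2)) a := by
      have h2 : ∀ k, (φ ^ k) (φ (a - φ a)) = (φ ^ (k + 1)) a - (φ ^ (k + 1 + 1)) a := fun k ↦ by
        simp [pow_succ]
      simp only [LinearMap.sum_apply, h2]
      rw [Finset.sum_range_sub' fun k ↦ (φ ^ (k + 1)) a]
      simp
    rw [LinearMap.smul_apply, h1, norm_smul, Complex.norm_real, Real.norm_of_nonneg (by positivity),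
      one_div, mul_comm]
    refine mul_le_mul_of_nonneg_right ?_ (by positivity)
    refine (norm_sub_le _ _).trans ?_
    linarith [hφ.toIsCPFixing.norm_map_le hX a,
      (hφ.toIsCPFixing.iterate (n + 2)).norm_map_le hX a]
  have h0 : ‖φ (a - φ a)‖ ≤ 0 := by
    refine ge_of_tendsto' (x := atTop) ?_ key
    simpa using (tendsto_one_div_add_atTop_nhds_zero_nat (𝕜 := ℝ)).const_mul (2 * ‖a‖)
  rw [norm_le_zero_iff, map_sub, sub_eq_zero] at h0
  exact h0.symm

/-- Rigidity of the range of a minimal map. -/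
lemma map_map_map (hX : 1 ∈ X) (hφ : IsMinimalCPFixing X φ) (hψ : IsCPFixing X ψ)
    (a : H →L[ℂ] H) : φ (ψ (φ a)) = φ a := by
  have hφψ : IsCPFixing X (φ ∘ₗ ψ) := hφ.toIsCPFixing.comp hψ
  have h1 := (hφ.comp_left hX hφψ).idempotent hX a
  have h2 := hφ.norm_map_map hX hφψ (a - φ (ψ (φ a)))
  simp only [LinearMap.comp_apply] at h1 h2
  rw [map_sub φ a, map_sub ψ, map_sub φ, h1, sub_self, norm_zero, eq_comm, norm_eq_zero,
    hφ.idempotent hX, sub_eq_zero] at h2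
  exact h2.symm

end IsMinimalCPFixing

end

end Silov

namespace Silov
open scoped ComplexOrder InnerProductSpace

section

variable {H : Type*} [NormedAddCommGroup H] [InnerProductSpace ℂ H] [CompleteSpace H]
  {X V : Submodule ℂ (H →L[ℂ] H)} {φ ψ : (H →L[ℂ] H) →ₗ[ℂ] (H →L[ℂ] H)}

omit [CompleteSpace H] in
lemma nonneg_iff_inner_nonneg {T : H →L[ℂ] H} : 0 ≤ T ↔ ∀ h, 0 ≤ ⟪h, T h⟫_ℂ := by
  rw [ContinuousLinearMap.nonneg_iff_isPositive, ContinuousLinearMap.isPositive_iff_complex]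
  refine forall_congr' fun h ↦ ?_
  rw [← inner_conj_symm, Complex.nonneg_iff]
  simp only [RCLike.re_eq_complex_re, Complex.conj_re, Complex.ext_iff, Complex.ofReal_re,
    Complex.ofReal_im, Complex.conj_im, true_and]
  rw [and_comm, zero_eq_neg, eq_comm]

lemma IsCP.map_nonneg (hφ : IsCP φ) {a : H →L[ℂ] H} (ha : 0 ≤ a) : 0 ≤ φ a := by
  obtain ⟨c, rfl⟩ := exists_eq_star_mul_self ha
  exact nonneg_iff_inner_nonneg.2 (hφ.inner_nonneg c)

/-- The Kadison-Schwarz inequality. -/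
lemma IsCP.star_mul_map_le (hφ : IsCP φ) (h1 : φ 1 = 1) (a : H →L[ℂ] H) :
    star (φ a) * φ a ≤ φ (star a * a) := by
  rw [← sub_nonneg, nonneg_iff_inner_nonneg]
  intro h
  rw [sub_apply, inner_sub_right, mul_apply_eq_comp, inner_star_apply, sub_nonneg]
  exact hφ.inner_map_self_le (by simp [h1]) a h

/-- An idempotent unital completely positive map is multiplicative against fixed points modulo
its kernel. -/
lemma IsCP.map_mul_eq_zero (hφ : IsCP φ) (h1 : φ 1 = 1) (hi : ∀ a, φ (φ a) = φ a)
    {x d : H →L[ℂ] H} (hx : φ x = x) (hd : φ d = 0) : φ (x * d) = 0 := by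
  have hxs : φ (star x) = star x := by rw [hφ.map_star, hx]
  have key : ∀ t : ℂ, 0 ≤ star t • φ (x * d) + t • star (φ (x * d)) + φ (star d * d) := by
    intro t
    have h2 := hφ.map_nonneg (sub_nonneg.2 (hφ.star_mul_map_le h1 (t • star x + d)))
    have h3 : star (t • star x + d) * (t • star x + d) = (star t * t) • (x * star x) +
        star t • (x * d) + t • star (x * d) + star d * d := by
      simp only [star_add, star_smul, star_star, star_mul, add_mul, mul_add, smul_mul_assoc,
        mul_smul_comm]
      module
    have h4 : φ (t • star x + d) = t • star x := by rw [map_add, map_smul, hxs, hd, add_zero]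
    rw [map_sub, hi, h4, h3, star_smul, star_star, smul_mul_smul_comm] at h2
    simp only [map_add, map_smul, hφ.map_star] at h2
    convert h2 using 1
    abel
  have hq : ∀ h, ⟪φ (x * d) h, h⟫_ℂ = 0 := by
    intro h
    set z := ⟪φ (x * d) h, h⟫_ℂ with hz
    set r := ⟪h, φ (star d * d) h⟫_ℂ
    have h2 : ∀ s : ℝ, 0 ≤ 2 * Complex.normSq z * s + r.re := by
      intro s
      have h3 := nonneg_iff_inner_nonneg.1 (key (s * star z)) h
      rw [add_apply, add_apply, inner_add_right, inner_add_right, smul_apply, smul_apply,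
        inner_smul_right, inner_smul_right, inner_star_apply, ← hz, ← inner_conj_symm, ← hz] at h3
      have h4 := (Complex.nonneg_iff.1 h3).1
      simp at h4
      rw [Complex.normSq_apply]
      linarith
    by_contra hne
    have hpos := Complex.normSq_pos.2 hne
    have h3 := h2 (-(r.re + 1) / (2 * Complex.normSq z))
    rw [mul_div_cancel₀ _ (by positivity)] at h3
    linarith
  ext h
  have : ((φ (x * d) : H →L[ℂ] H) : H →ₗ[ℂ] H) = 0 := inner_map_self_eq_zero _ |>.1 hq
  exact congrArg (fun T : H →ₗ[ℂ] H ↦ T h) this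

/-- Elements of `C*(X)` multiply the kernel of a selfadjoint map into itself as soon as
elements of `X` do. -/
lemma map_mul_eq_zero_of_mem_cstarGenerated {D : (H →L[ℂ] H) →ₗ[ℂ] (H →L[ℂ] H)}
    (hc : Continuous D) (hs : ∀ a, D (star a) = star (D a))
    (hX : ∀ x ∈ X, ∀ d, D d = 0 → D (x * d) = 0 ∧ D (d * x) = 0) :
    ∀ c ∈ cstarGenerated X, ∀ d, D d = 0 → D (c * d) = 0 ∧ D (d * c) = 0 := by
  let S : StarSubalgebra ℂ (H →L[ℂ] H) :=
    { carrier := {c | ∀ d, D d = 0 → D (c * d) = 0 ∧ D (d * c) = 0}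
      mul_mem' := fun {a b} ha hb d hd ↦ by
        rw [mul_assoc, ← mul_assoc]
        exact ⟨(ha _ (hb d hd).1).1, (hb _ (ha d hd).2).2⟩
      add_mem' := fun {a b} ha hb d hd ↦ by
        simp [add_mul, mul_add, ha d hd, hb d hd]
      algebraMap_mem' := fun r d hd ↦ by
        simp [Algebra.algebraMap_eq_smul_one, hd]
      star_mem' := fun {a} ha d hd ↦ by
        have h := ha (star d) (by rw [hs, hd, star_zero])
        constructor
        · rw [← star_star d, ← star_mul, hs, h.2, star_zero]
        · rw [← star_star d, ← star_mul, hs, h.1, star_zero] }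
  have hS : IsClosed (S : Set (H →L[ℂ] H)) := by
    have : (S : Set (H →L[ℂ] H)) =
        ⋂ (d) (_ : D d = 0), {c | D (c * d) = 0} ∩ {c | D (d * c) = 0} := by
      ext c
      simp only [Set.mem_iInter]
      rfl
    rw [this]
    refine isClosed_iInter fun d ↦ isClosed_iInter fun _ ↦ IsClosed.inter ?_ ?_
    · exact isClosed_eq (hc.comp (continuous_id.mul continuous_const)) continuous_const
    · exact isClosed_eq (hc.comp (continuous_const.mul continuous_id)) continuous_const
  exact fun c h ↦ StarSubalgebra.topologicalClosure_minimal
    (StarAlgebra.adjoin_le (S := S) hX) hS h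

lemma map_star_mul_eq_of_idempotent {η : (H →L[ℂ] H) →ₗ[ℂ] (H →L[ℂ] H)} (hφ : IsCP φ)
    (hη : IsCP η) (hφ1 : φ 1 = 1) (hη1 : η 1 = 1) (h1 : ∀ a, φ (η a) = η a)
    (h2 : ∀ a, η (φ a) = φ a) {a b : H →L[ℂ] H} (ha : φ a = a) (hb : φ b = b) :
    η (star a * b) = φ (star a * b) := by
  have hsq : ∀ a, φ a = a → η (star a * a) = φ (star a * a) := by
    intro a ha
    have ha' : η a = a := by rw [← ha, h2]
    refine le_antisymm ?_ ?_
    · have := hη.map_nonneg (sub_nonneg.2 (hφ.star_mul_map_le hφ1 a))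
      rwa [ha, map_sub, h2, sub_nonneg] at this
    · have := hφ.map_nonneg (sub_nonneg.2 (hη.star_mul_map_le hη1 a))
      rwa [ha', map_sub, h1, sub_nonneg] at this
  have e1 := hsq (a + b) (by rw [map_add, ha, hb])
  have e2 := hsq (a + Complex.I • b) (by rw [map_add, map_smul, ha, hb])
  have ea := hsq a ha
  have eb := hsq b hb
  simp only [star_add, star_smul, add_mul, mul_add, map_add, ea, eb, smul_mul_assoc,
    mul_smul_comm, map_smul] at e1 e2
  have e1' : η (star a * b) + η (star b * a) = φ (star a * b) + φ (star b * a) := by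
    linear_combination (norm := module) e1
  have e2' : η (star a * b) - η (star b * a) = φ (star a * b) - φ (star b * a) := by
    have : Complex.I • (η (star a * b) - η (star b * a)) =
        Complex.I • (φ (star a * b) - φ (star b * a)) := by
      simp only [RCLike.star_def, Complex.conj_I, neg_smul] at e2
      simp only [smul_sub]
      linear_combination (norm := module) e2
    exact smul_right_injective _ Complex.I_ne_zero this
  have e3 : (2 : ℂ) • η (star a * b) = (2 : ℂ) • φ (star a * b) := by
    rw [two_smul, two_smul]
    linear_combination (norm := module) e1' + e2'
  exact smul_right_injective _ two_ne_zero e3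

namespace IsMinimalCPFixing

lemma map_mul_eq_zero (hX : 1 ∈ X) (hφ : IsMinimalCPFixing X φ) :
    ∀ c ∈ cstarGenerated X, ∀ d, φ d = 0 → φ (c * d) = 0 ∧ φ (d * c) = 0 := by
  have h1 := hφ.map_eq 1 hX
  refine map_mul_eq_zero_of_mem_cstarGenerated (hφ.toIsCPFixing.continuous hX) hφ.isCP.map_star
    fun x hx d hd ↦ ⟨hφ.isCP.map_mul_eq_zero h1 (hφ.idempotent hX) (hφ.map_eq x hx) hd, ?_⟩
  rw [← star_star (d * x), hφ.isCP.map_star, star_mul,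
    hφ.isCP.map_mul_eq_zero h1 (hφ.idempotent hX), star_zero]
  · rw [hφ.isCP.map_star, hφ.map_eq x hx]
  · rw [hφ.isCP.map_star, hd, star_zero]

/-- On `C*(X)` a minimal map is unchanged by composition with maps fixing `X`. -/
lemma map_map_eq (hX : 1 ∈ X) (hφ : IsMinimalCPFixing X φ) (hψ : IsCPFixing X ψ)
    {c : H →L[ℂ] H} (hc : c ∈ cstarGenerated X) : φ (ψ c) = φ c := by
  set η := φ ∘ₗ ψ with hη
  have hηf : IsCPFixing X η := hφ.toIsCPFixing.comp hψ
  have hφi := hφ.idempotent hX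
  have hφη : ∀ a, φ (η a) = η a := fun a ↦ hφi _
  have hηφ : ∀ a, η (φ a) = φ a := hφ.map_map_map hX hψ
  have hηi : ∀ a, η (η a) = η a := fun a ↦ hηφ (ψ a)
  have h1 := hφ.map_eq 1 hX
  have hη1 := hηf.map_eq 1 hX
  have hmul : ∀ x, φ x = x → ∀ d, η d = φ d → η (x * d) = φ (x * d) := by
    intro x hx d hd
    have hx' : η x = x := by rw [← hx, hηφ]
    have e1 : φ (x * (d - φ d)) = 0 :=
      hφ.isCP.map_mul_eq_zero h1 hφi hx (by rw [map_sub, hφi, sub_self])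
    have e2 : η (x * (d - φ d)) = 0 :=
      hηf.isCP.map_mul_eq_zero hη1 hηi hx' (by rw [map_sub, hηφ, hd, sub_self])
    have e3 := map_star_mul_eq_of_idempotent hφ.isCP hηf.isCP h1 hη1 hφη hηφ
      (a := star x) (b := φ d) (by rw [hφ.isCP.map_star, hx]) (hφi d)
    rw [mul_sub, map_sub, sub_eq_zero] at e1 e2
    rw [star_star] at e3
    rw [e1, e2, e3]
  have hs : ∀ a, (η - φ) (star a) = star ((η - φ) a) := fun a ↦ by
    simp [hηf.isCP.map_star, hφ.isCP.map_star]
  have hD : ∀ x ∈ X, ∀ d, (η - φ) d = 0 → (η - φ) (x * d) = 0 ∧ (η - φ) (d * x) = 0 := by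
    intro x hx d hd
    refine ⟨sub_eq_zero.2 (hmul x (hφ.map_eq x hx) d (sub_eq_zero.1 hd)), ?_⟩
    have hd' : (η - φ) (star d) = 0 := by rw [hs, hd, star_zero]
    rw [← star_star (d * x), hs, star_mul, LinearMap.sub_apply,
      hmul (star x) (by rw [hφ.isCP.map_star, hφ.map_eq x hx]) (star d) (sub_eq_zero.1 hd'),
      sub_self, star_zero]
  have hcont : Continuous (η - φ) :=
    (hηf.continuous hX).sub (hφ.toIsCPFixing.continuous hX)
  have := (map_mul_eq_zero_of_mem_cstarGenerated hcont hs hD c hc 1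
    (by rw [LinearMap.sub_apply, h1, hη1, sub_self])).1
  rw [mul_one] at this
  exact sub_eq_zero.1 this

lemma map_eq_zero (hX : 1 ∈ X) (hφ : IsMinimalCPFixing X φ)
    (hV : QuotientCompletelyIsometricOn X V) {v : H →L[ℂ] H} (hv : v ∈ V)
    (hvC : v ∈ cstarGenerated X) : φ v = 0 := by
  obtain ⟨ψ, hψ, hψV⟩ := exists_isCPFixing_vanishing hX hV
  rw [← hφ.map_map_eq hX hψ hvC, hψV v hv, map_zero]

end IsMinimalCPFixing

lemma mem_idealSubspace {C : StarSubalgebra ℂ (H →L[ℂ] H)} {I : TwoSidedIdeal C}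
    {a : H →L[ℂ] H} : a ∈ idealSubspace I ↔ ∃ h : a ∈ C, (⟨a, h⟩ : C) ∈ I := by
  constructor
  · rintro ⟨c, hc, rfl⟩
    exact ⟨c.2, TwoSidedIdeal.mem_asIdeal.1 hc⟩
  · rintro ⟨h, ha⟩
    exact ⟨⟨a, h⟩, TwoSidedIdeal.mem_asIdeal.2 ha, rfl⟩

lemma idealSubspace_mono {C : StarSubalgebra ℂ (H →L[ℂ] H)} {I J : TwoSidedIdeal C} (h : I ≤ J) :
    idealSubspace I ≤ idealSubspace J := fun _ ha ↦ by
  obtain ⟨h', ha⟩ := mem_idealSubspace.1 ha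
  exact mem_idealSubspace.2 ⟨h', h ha⟩

/-- The Šilov ideal: the kernel in `C*(X)` of a minimal completely positive map fixing `X`. -/
noncomputable def kerIdeal (hX : 1 ∈ X) (hφ : IsMinimalCPFixing X φ) : TwoSidedIdeal (cstarGenerated X) :=
  TwoSidedIdeal.mk' {c | φ c = 0} (map_zero φ)
    (fun {x y} hx hy ↦ by
      have hx : φ x = 0 := hx
      have hy : φ y = 0 := hy
      change φ (x + y) = 0
      rw [map_add, hx, hy, add_zero])
    (fun {x} hx ↦ by
      have hx : φ x = 0 := hx
      change φ (-x) = 0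
      rw [map_neg, hx, neg_zero])
    (fun {x y} hy ↦ (hφ.map_mul_eq_zero hX x x.2 y hy).1)
    (fun {x y} hx ↦ (hφ.map_mul_eq_zero hX y y.2 x hx).2)

lemma mem_kerIdeal {hX : 1 ∈ X} {hφ : IsMinimalCPFixing X φ} {c : cstarGenerated X} :
    c ∈ kerIdeal hX hφ ↔ φ c = 0 :=
  TwoSidedIdeal.mem_mk' _ _ _ _ _ _ _

lemma mem_idealSubspace_kerIdeal {hX : 1 ∈ X} {hφ : IsMinimalCPFixing X φ} {a : H →L[ℂ] H} :
    a ∈ idealSubspace (kerIdeal hX hφ) ↔ a ∈ cstarGenerated X ∧ φ a = 0 := by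
  rw [mem_idealSubspace]
  exact ⟨fun ⟨h, ha⟩ ↦ ⟨h, mem_kerIdeal.1 ha⟩, fun ⟨h, ha⟩ ↦ ⟨h, mem_kerIdeal.2 ha⟩⟩

lemma QuotientCompletelyIsometricOn.of_map_eq_zero (hX : 1 ∈ X) (hφ : IsCPFixing X φ)
    (hV : ∀ v ∈ V, φ v = 0) : QuotientCompletelyIsometricOn X V := by
  refine quotientCompletelyIsometricOn_of_norm_le fun n x hx v hv ↦ ?_
  have : x = (x + v).map φ := by
    ext1 i j
    rw [CStarMatrix.map_apply, CStarMatrix.add_apply, map_add, hφ.map_eq _ (hx i j), hV _ (hv i j),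
      add_zero]
  rw [this]
  convert hφ.isCP.norm_map_matrix_le (hφ.map_eq 1 hX) (x + v) using 3
  exact this.symm

lemma le_idealSubspace_kerIdeal {hX : 1 ∈ X} {hφ : IsMinimalCPFixing X φ}
    (hVC : V ≤ subalgebraSubspace (cstarGenerated X))
    (hV : QuotientCompletelyIsometricOn X V) : V ≤ idealSubspace (kerIdeal hX hφ) :=
  fun _ hv ↦ mem_idealSubspace_kerIdeal.2 ⟨hVC hv, hφ.map_eq_zero hX hV hv (hVC hv)⟩

lemma isSilovIdeal_kerIdeal (hX : 1 ∈ X) (hφ : IsMinimalCPFixing X φ) :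
    IsSilovIdeal X (kerIdeal hX hφ) := by
  refine ⟨⟨?_, .of_map_eq_zero hX hφ.toIsCPFixing fun v hv ↦
    (mem_idealSubspace_kerIdeal.1 hv).2⟩, fun J hJ c hc ↦ ?_⟩
  · simp only [mem_kerIdeal]
    exact isClosed_eq ((hφ.toIsCPFixing.continuous hX).comp continuous_subtype_val)
      continuous_const
  · exact mem_kerIdeal.2 (hφ.map_eq_zero hX hJ.completelyIsometric
      (mem_idealSubspace.2 ⟨c.2, hc⟩) c.2)

lemma isClosed_idealSubspace_kerIdeal (hX : 1 ∈ X) (hφ : IsMinimalCPFixing X φ) :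
    IsClosed (idealSubspace (kerIdeal hX hφ) : Set (H →L[ℂ] H)) := by
  have : (idealSubspace (kerIdeal hX hφ) : Set (H →L[ℂ] H)) =
      (cstarGenerated X : Set (H →L[ℂ] H)) ∩ {a | φ a = 0} :=
    Set.ext fun _ ↦ mem_idealSubspace_kerIdeal
  rw [this]
  exact (StarSubalgebra.isClosed_topologicalClosure _).inter
    (isClosed_eq (hφ.toIsCPFixing.continuous hX) continuous_const)

lemma isBoundaryIdeal_closedIdealGenerated (hX : 1 ∈ X) (hφ : IsMinimalCPFixing X φ)
    (hVC : V ≤ subalgebraSubspace (cstarGenerated X)) (hV : QuotientCompletelyIsometricOn X V) :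
    IsBoundaryIdeal X (closedIdealGenerated (cstarGenerated X) V) := by
  have hle : closedIdealGenerated (cstarGenerated X) V ≤ kerIdeal hX hφ :=
    sInf_le ⟨(isSilovIdeal_kerIdeal hX hφ).1.isClosed, le_idealSubspace_kerIdeal hVC hV⟩
  refine ⟨?_, .of_map_eq_zero hX hφ.toIsCPFixing fun v hv ↦
    (mem_idealSubspace_kerIdeal.1 (idealSubspace_mono hle hv)).2⟩
  simp only [closedIdealGenerated, TwoSidedIdeal.mem_sInf, Set.ofPred_forall]
  exact isClosed_iInter fun J ↦ isClosed_iInter fun hJ ↦ hJ.1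

end

end Silov

theorem mainTheorem4 {H : Type*} [NormedAddCommGroup H] [InnerProductSpace ℂ H] [CompleteSpace H]
    (X : Submodule ℂ (H →L[ℂ] H)) (hX : (1 : H →L[ℂ] H) ∈ X) :
    (∃ I : TwoSidedIdeal (Silov.cstarGenerated X), Silov.IsSilovIdeal X I ∧
      (∀ V : Submodule ℂ (H →L[ℂ] H),
        Silov.IsBoundarySubsystem X (Silov.subalgebraSubspace (Silov.cstarGenerated X)) V →
          V ≤ Silov.idealSubspace I) ∧
      (Submodule.span ℂ {a : H →L[ℂ] H |
          a ∈ Silov.cstarGenerated X ∧ Silov.IsBoundaryElement X a}).topologicalClosure ≤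
        Silov.idealSubspace I) ∧
    (∀ V : Submodule ℂ (H →L[ℂ] H),
      Silov.IsBoundarySubsystem X (Silov.subalgebraSubspace (Silov.cstarGenerated X)) V →
        Silov.IsBoundaryIdeal X (Silov.closedIdealGenerated (Silov.cstarGenerated X) V)) := by
  obtain ⟨φ, hφ⟩ := Silov.exists_isMinimalCPFixing hX
  refine ⟨⟨Silov.kerIdeal hX hφ, Silov.isSilovIdeal_kerIdeal hX hφ,
    fun V hV ↦ Silov.le_idealSubspace_kerIdeal hV.le hV.completelyIsometric,
    Submodule.topologicalClosure_minimal _ (Submodule.span_le.2 fun a ha ↦ ?_)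
      (Silov.isClosed_idealSubspace_kerIdeal hX hφ)⟩,
    fun V hV ↦ Silov.isBoundaryIdeal_closedIdealGenerated hX hφ hV.le hV.completelyIsometric⟩
  exact Silov.mem_idealSubspace_kerIdeal.2 ⟨ha.1, hφ.map_eq_zero hX ha.2.2.completelyIsometric
    (Submodule.mem_span_singleton_self a) ha.1⟩
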